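/- Let $\mu>0$ (shear modulus), $\nu\in(-1,\tfrac12)$ (Poisson's ratio), $\eta=\nu/(1-\nu)$. For $z\in\mathbb R^2\setminus\{0\}$ let $$\Gamma(z)=\frac{\mu}{16\pi(1-\nu)|z|^3}\begin{pmatrix}\nu+1-3\nu\frac{z_2^2}{|z|^2}&3\nu\frac{z_1z_2}{|z|^2}\\ 3\nu\frac{z_1z_2}{|z|^2}&\nu+1-3\nu\frac{z_1^2}{|z|^2}\end{pmatrix}$$ be the singular interaction kernel of a cubic crystal with isotropic elasticity, and for $b\in\mathbb R^2$ and $n\in S^1$, with $n^\perp=(-n_2,n_1)$, let $\psi_0(b,n)=2\int_{\mathbb R}\Gamma(n+tn^\perp)b\cdot b\,dt$ be the line tension of a straight dislocation. A dislocation network consists of finitely many oriented rectifiable curves $\gamma_i$ in $\mathbb R^2$ with Burgers vectors $b_i\in\mathbb Z^2$, which overlap at most on a set of length zero. For $b\in\mathbb Z^2$ let $$\psi_{\rm rel}(b,n)=\inf\sum_i\int_{\gamma_i}\psi_0(b_i,\nu_{\gamma_i})\,ds,$$ where $\nu_{\gamma_i}$ is the unit normal to $\gamma_i$ and the infimum is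 over all networks that start at $0$ and end at $n^\perp$ with total Burgers vector $b$, the Burgers vector being conserved at all other points. Put $\psi_\infty(b,n)=\liminf_{s\to\infty}\frac1s\psi_{\rm rel}(sb,n)$, over those $s$ for which $sb\in\mathbb Z^2$. For $\sigma>0$ and $0\le2\delta<\sigma$ let $\ell=\sqrt{\delta^2+(\sigma/2-\delta)^2}$, $\bar n=(\sigma/2-\delta,\delta)/\ell$, $\bar n'=(\delta,\sigma/2-\delta)/\ell$, and let $$e(\delta)=2\sqrt2\,\delta\,\psi_\infty\Bigl(\sigma(e_1+e_2),\tfrac{e_1-e_2}{\sqrt2}\Bigr)+2\ell\bigl(\psi_\infty(\sigma e_1,\bar n)+\psi_\infty(\sigma e_2,\bar n')\bigr)$$ be the energy of the zig-zag network in one $\sigma\times\sigma$ cell. Then: 1. $\psi_\infty(ke_i,n)=\frac{\mu}{4\pi}|k|\,(1+\eta(n\cdot e_i)^2)$ for $i=1,2$, $k\in\mathbb R$, $n\in S^1$. 2. If $\nu\ge0$, then $\psi_\infty\bigl(k(e_1+e_2),\frac{e_1-e_2}{\sqrt2}\bigr)=\frac{\mu}{4\pi}\,2|k|$ for $k\in\mathbb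 R$. 3. If $\nu\ge0$, then for $\sigma>0$ and $0\le2\delta<\sigma$ $$e(\delta)=4\sigma\frac{\mu}{4\pi}\Bigl[\ell+\eta\frac{(\sigma/2-\delta)^2}{\ell}+\sqrt2\,\delta\Bigr]=4\sigma^2\frac{\mu}{4\pi}\Bigl[\frac{1+\eta}2+\frac\delta\sigma(\sqrt2-1-\eta)+O\Bigl(\frac{\delta^2}{\sigma^2}\Bigr)\Bigr],$$ where the constant in $O$ is universal. 4. $e(0)=\sigma\psi_\infty(\sigma e_1,e_1)+\sigma\psi_\infty(\sigma e_2,e_2)$, the energy of the plain square grid in the cell. 5. $\eta>\sqrt2-1$ if and only if $\nu>1-1/\sqrt2$. In this case there is $c\in(0,\tfrac12]$, depending only on $\nu$, such that for all $\mu,\sigma>0$ and all $0<\delta<c\sigma$ the zig-zag network has strictly lower energy than the plain square grid: $e(\delta)<e(0)$. -/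

import Mathlib

open MeasureTheory Filter
open scoped ENNReal NNReal Topology

noncomputable section

/-- The slip plane `ℝ²` with its Euclidean norm. -/
abbrev Plane : Type := EuclideanSpace ℝ (Fin 2)

namespace Plane

/-- The standard basis vector `e i`; the indices `0, 1` stand for `1, 2`. -/
def e (i : Fin 2) : Plane := EuclideanSpace.single i 1

/-- `v^⊥ = (-v₂, v₁)`. -/
def perp (v : Plane) : Plane := !₂[-(v 1), v 0]

/-- The unit normal of a line with tangent direction `v ≠ 0`:
the unit vector `n` for which `n^⊥ = v / |v|`. -/
def normalOf (v : Plane) : Plane := ‖v‖⁻¹ • !₂[v 1, -(v 0)]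

/-- An integer vector, seen in `ℝ²`. -/
def ofInt (b : Fin 2 → ℤ) : Plane := WithLp.toLp 2 (fun i => (b i : ℝ))

end Plane

/-- The singular part of the interaction kernel of an elastically isotropic cubic crystal with
shear modulus `μ` and Poisson's ratio `ν`. -/
def cubicKernel (μ ν : ℝ) (z : Plane) : Matrix (Fin 2) (Fin 2) ℝ :=
  (μ / (16 * Real.pi * (1 - ν) * ‖z‖ ^ 3)) •
    !![ν + 1 - 3 * ν * (z 1 ^ 2 / ‖z‖ ^ 2), 3 * ν * (z 0 * z 1 / ‖z‖ ^ 2);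
       3 * ν * (z 0 * z 1 / ‖z‖ ^ 2), ν + 1 - 3 * ν * (z 0 ^ 2 / ‖z‖ ^ 2)]

/-- The prelogarithmic factor `ψ₀(b, n) = 2 ∫_ℝ Γ(n + t n^⊥) b · b dt` of a straight dislocation
with Burgers vector `b` and unit normal `n`, for the kernel `Γ`. -/
def lineTension (Γ : Plane → Matrix (Fin 2) (Fin 2) ℝ) (b n : Plane) : ℝ :=
  2 * ∫ t : ℝ, ((Γ (n + t • Plane.perp n)).mulVec (fun j => b j)) ⬝ᵥ (fun j => b j)

/-- A dislocation network: finitely many oriented rectifiable curves `γ i : [0, 1] → ℝ²`, given by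
Lipschitz parametrizations, each with a Burgers vector in `ℤ²`. The curves may meet and branch,
but they do not run on top of each other (or of themselves): the points covered more than once
form a set of length zero. Parallel dislocations are thus distinct curves, and a segment
on which Burgers vectors add up is one curve that carries their sum. -/
structure DislocationNetwork where
  M : ℕ
  γ : Fin M → ℝ → Plane
  burgers : Fin M → Fin 2 → ℤ
  lipschitz : ∀ i, ∃ K : ℝ≥0, LipschitzOnWith K (γ i) (Set.Icc 0 1)
  overlap_null : Measure.hausdorffMeasure 1
    {x : Plane | ∃ p q : Fin M × ℝ, p ≠ q ∧ p.2 ∈ Set.Icc (0 : ℝ) 1 ∧ q.2 ∈ Set.Icc (0 : ℝ) 1 ∧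
      γ p.1 p.2 = x ∧ γ q.1 q.2 = x} = 0

namespace DislocationNetwork

/-- The line-tension energy `∑ i, ∫_{γ i} ψ₀(b i, n) ds`, with `n` the unit normal of `γ i`. -/
def energy (ψ₀ : Plane → Plane → ℝ) (𝒩 : DislocationNetwork) : ℝ≥0∞ :=
  ∑ i, ∫⁻ t in Set.Icc (0 : ℝ) 1,
    ENNReal.ofReal (ψ₀ (Plane.ofInt (𝒩.burgers i)) (Plane.normalOf (deriv (𝒩.γ i) t)))
      * ENNReal.ofReal ‖deriv (𝒩.γ i) t‖

open scoped Classical in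
/-- The sum of the Burgers vectors of the curves that start at `x`. -/
def starting (𝒩 : DislocationNetwork) (x : Plane) : Plane :=
  ∑ i, if 𝒩.γ i 0 = x then Plane.ofInt (𝒩.burgers i) else 0

open scoped Classical in
/-- The sum of the Burgers vectors of the curves that end at `x`. -/
def ending (𝒩 : DislocationNetwork) (x : Plane) : Plane :=
  ∑ i, if 𝒩.γ i 1 = x then Plane.ofInt (𝒩.burgers i) else 0

open scoped Classical in
/-- The network starts at `p` and ends at `q` with total Burgers vector `b`: the Burgers
vector is conserved at every point, up to a source `b` at `p` and a sink `b` at `q`. -/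
def Carries (𝒩 : DislocationNetwork) (b p q : Plane) : Prop :=
  ∀ x, 𝒩.starting x - 𝒩.ending x = (if x = p then b else 0) - (if x = q then b else 0)

end DislocationNetwork

/-- The relaxed line tension `ψ_rel(b, n)`: the least energy of a network that starts
at `0` and ends at `n^⊥` with total Burgers vector `b`. As Burgers vectors are integer, it is the
infimum of the empty set, `+∞`, if `b ∉ ℤ²`. -/
def relaxedLineTension (ψ₀ : Plane → Plane → ℝ) (b n : Plane) : ℝ≥0∞ :=
  ⨅ (𝒩 : DislocationNetwork) (_ : 𝒩.Carries b 0 (Plane.perp n)), 𝒩.energy ψ₀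

/-- `ψ_∞(b, n) = liminf_{s → ∞} (1/s) ψ_rel(s b, n)`. Since `ψ_rel` is `+∞` off `ℤ²`, only the `s`
with `s b ∈ ℤ²` count. -/
def asymptoticLineTension (ψ₀ : Plane → Plane → ℝ) (b n : Plane) : ℝ≥0∞ :=
  liminf (fun s : ℝ => ENNReal.ofReal (1 / s) * relaxedLineTension ψ₀ (s • b) n) atTop

/-- `ψ_∞` of an elastically isotropic cubic crystal. -/
def psiInfCubic (μ ν : ℝ) (b n : Plane) : ℝ≥0∞ :=
  asymptoticLineTension (lineTension (cubicKernel μ ν)) b n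

/-- The material parameter `η = ν / (1 - ν)`. -/
def etaOf (ν : ℝ) : ℝ := ν / (1 - ν)

/-- The direction `(e₁ - e₂) / √2`. -/
def diagNormal : Plane := (1 / √2 : ℝ) • (Plane.e 0 - Plane.e 1)

/-- The energy `e(δ)`, in one cell of size `σ × σ`, of the zig-zag network: a central segment of
length `2 √2 δ` at 45 degrees with Burgers vector `σ(e₁ + e₂)`, and two pairs of segments of length
`√(δ² + (σ/2 - δ)²)` that join it to the boundary of the cell, with Burgers vectors `σ e₁`
and `σ e₂` and normals along `(σ/2 - δ, δ)` and `(δ, σ/2 - δ)`. -/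
def zigzagEnergy (μ ν σ δ : ℝ) : ℝ≥0∞ :=
  let ℓ : ℝ := √(δ ^ 2 + (σ / 2 - δ) ^ 2)
  let n₁ : Plane := (1 / ℓ) • !₂[σ / 2 - δ, δ]
  let n₂ : Plane := (1 / ℓ) • !₂[δ, σ / 2 - δ]
  ENNReal.ofReal (2 * δ * √2) * psiInfCubic μ ν (σ • (Plane.e 0 + Plane.e 1)) diagNormal
    + ENNReal.ofReal (2 * ℓ) *
      (psiInfCubic μ ν (σ • Plane.e 0) n₁ + psiInfCubic μ ν (σ • Plane.e 1) n₂)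

/-- The energy, in one cell of size `σ × σ`, of the plain square grid: one segment of length `σ`
with Burgers vector `σ e₁` and normal `e₁`, and one with Burgers vector `σ e₂` and normal `e₂`. -/
def squareGridEnergy (μ ν σ : ℝ) : ℝ≥0∞ :=
  ENNReal.ofReal σ * psiInfCubic μ ν (σ • Plane.e 0) (Plane.e 0)
    + ENNReal.ofReal σ * psiInfCubic μ ν (σ • Plane.e 1) (Plane.e 1)

end

/-! The substitution `t = tan θ` gives `ψ₀(b, n) = μ/(4π) (|b|² + η (b·n)²)`, and two bounds then
determine `ψ_∞`. Upper bound: for integer `b`, the vector `m b` can be carried by `m` nearly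
straight arcs with Burgers vector `b` that meet only at their endpoints. So the cost grows linearly
in `m`, although `ψ₀` is quadratic in `b`. Lower bound: a linear functional `a` and a vector `p`
with `a(b) (p·m) ≤ ψ₀(b, m)` for all integer `b` and unit `m` form a calibration. Integrated along
the curves, conservation of the Burgers vector collapses the left side to its value on the source
and sink (`ofReal_le_energy_of_calibration`). For `e_i`, `a` is the `i`-th coordinate up to sign and
`p` is the gradient at `n` of the 1-homogeneous extension of `μ/(4π) (1 + η m_i²)`, which is convex
because `-1/2 ≤ η ≤ 1`; integrality enters through `|k| ≤ k²`. For `e₁ + e₂` with `η ≥ 0`, the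
`η`-term is dropped. The zig-zag energy is then explicit, with slope proportional to `√2 - 1 - η` at
`δ = 0`. -/

noncomputable section

open Plane

/-! ### The explicit line tension of a straight dislocation -/

namespace Plane

theorem sq_add_sq_of_norm_eq_one {n : Plane} (hn : ‖n‖ = 1) : n 0 ^ 2 + n 1 ^ 2 = 1 := by
  have h := EuclideanSpace.norm_sq_eq n
  rw [hn, Fin.sum_univ_two] at h
  simpa using h.symm

theorem norm_eq_sqrt (v : Plane) : ‖v‖ = √(v 0 ^ 2 + v 1 ^ 2) := by
  simp [EuclideanSpace.norm_eq, Fin.sum_univ_two]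

theorem norm_sq_eq_add (v : Plane) : ‖v‖ ^ 2 = v 0 ^ 2 + v 1 ^ 2 := by
  simp [EuclideanSpace.norm_sq_eq, Fin.sum_univ_two]

theorem inner_eq_add (v w : Plane) : inner ℝ v w = v 0 * w 0 + v 1 * w 1 := by
  simp [PiLp.inner_apply, Fin.sum_univ_two, mul_comm]

@[simp] theorem perp_zero (v : Plane) : perp v 0 = -v 1 := rfl

@[simp] theorem perp_one (v : Plane) : perp v 1 = v 0 := rfl

theorem norm_perp (v : Plane) : ‖perp v‖ = ‖v‖ := by
  rw [norm_eq_sqrt, norm_eq_sqrt, perp_zero, perp_one, neg_sq, add_comm]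

end Plane

/-- The value of `ψ₀` at a unit normal `n`. -/
theorem lineTension_cubicKernel {μ ν : ℝ} (hν : ν < 1) (b : Plane) {n : Plane} (hn : ‖n‖ = 1) :
    lineTension (cubicKernel μ ν) b n =
      μ / (4 * Real.pi) * (‖b‖ ^ 2 + etaOf ν * (inner ℝ b n) ^ 2) := by
  have hn1 := sq_add_sq_of_norm_eq_one hn
  set K : ℝ := μ / (16 * Real.pi * (1 - ν)) with hK
  set α : ℝ := b 0 * n 0 + b 1 * n 1 with hα
  set β : ℝ := b 1 * n 0 - b 0 * n 1 with hβ
  set B : ℝ := b 0 ^ 2 + b 1 ^ 2 with hB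
  have hBαβ : B = α ^ 2 + β ^ 2 := by
    rw [hB, hα, hβ]; linear_combination (-(b 0 ^ 2 + b 1 ^ 2)) * hn1
  -- The quadratic form of the kernel is `(ν+1)|b|² - 3ν (b·z^⊥)²/|z|²` up to a factor. For `z = n +
  -- tan θ n^⊥`, the unit vector along `z^⊥` is `cos θ n^⊥ - sin θ n`; `α`, `β` are the components
  -- of `b` along `n`, `n^⊥`.
  let g : ℝ → ℝ := fun θ =>
    K * Real.cos θ * ((ν + 1) * B - 3 * ν * (β * Real.cos θ - α * Real.sin θ) ^ 2)
  let G : ℝ → ℝ := fun θ => K * ((ν + 1) * B * Real.sin θ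
    - 3 * ν * (β ^ 2 * (Real.sin θ - Real.sin θ ^ 3 / 3) + 2 * α * β * (Real.cos θ ^ 3 / 3)
      + α ^ 2 * (Real.sin θ ^ 3 / 3)))
  have hG : ∀ θ, HasDerivAt G (g θ) θ := by
    intro θ
    have hs := Real.hasDerivAt_sin θ
    have hc := Real.hasDerivAt_cos θ
    have h := ((hs.const_mul ((ν + 1) * B)).sub
      (((((hs.sub ((hs.pow 3).div_const 3)).const_mul (β ^ 2)).add
        (((hc.pow 3).div_const 3).const_mul (2 * α * β))).add
        (((hs.pow 3).div_const 3).const_mul (α ^ 2))).const_mul (3 * ν))).const_mul K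
    refine h.congr_deriv ?_
    simp only [g]
    have := Real.sin_sq_add_cos_sq θ
    simp only [Nat.cast_ofNat, Nat.add_one_sub_one]
    linear_combination (3 * K * ν * β ^ 2 * Real.cos θ) * this
  have hgc : Continuous g := by fun_prop
  have hGc : Continuous G := by fun_prop
  have hpt : ∀ t : ℝ, ((cubicKernel μ ν (n + t • perp n)).mulVec (fun j => b j)) ⬝ᵥ (fun j => b j)
      = (1 + t ^ 2)⁻¹ * g (Real.arctan t) := by
    intro t
    have hz0 : (n + t • perp n) 0 = n 0 - t * n 1 := by simp; ring
    have hz1 : (n + t • perp n) 1 = n 1 + t * n 0 := by simp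
    have hz : ‖n + t • perp n‖ = √(1 + t ^ 2) := by
      rw [norm_eq_sqrt, hz0, hz1]; congr 1
      linear_combination (1 + t ^ 2) * hn1
    have hpos : 0 < 1 + t ^ 2 := by positivity
    have hw : 0 < √(1 + t ^ 2) := Real.sqrt_pos.2 hpos
    have hw2 : √(1 + t ^ 2) ^ 2 = 1 + t ^ 2 := Real.sq_sqrt hpos.le
    simp only [g, Real.cos_arctan, Real.sin_arctan, cubicKernel, hz, hz0, hz1,
      Matrix.mulVec, dotProduct, Fin.sum_univ_two, Matrix.smul_apply, Matrix.of_apply,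
      Matrix.cons_val_zero, Matrix.cons_val_one, smul_eq_mul, Matrix.cons_val_fin_one]
    rw [hK, show (1 + t ^ 2)⁻¹ = (√(1 + t ^ 2) ^ 2)⁻¹ by rw [hw2]]
    set w := √(1 + t ^ 2)
    have hν' : (1 - ν) ≠ 0 := by linarith
    have hα' : β - α * t = b 1 * (n 0 - t * n 1) - b 0 * (n 1 + t * n 0) := by
      rw [hα, hβ]; ring
    have hq : β * (1 / w) - α * (t / w) =
        (b 1 * (n 0 - t * n 1) - b 0 * (n 1 + t * n 0)) / w := by rw [← hα']; ring
    rw [hq, hB]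
    field_simp
    ring
  obtain ⟨C, hC⟩ : ∃ C, ∀ θ, ‖g θ‖ ≤ C := by
    have hper : Function.Periodic g (2 * Real.pi) := fun θ => by
      simp only [g, Real.cos_add_two_pi, Real.sin_add_two_pi]
    have hcomp := hper.compact_of_continuous Real.two_pi_pos.ne' hgc
    obtain ⟨C, hC⟩ := hcomp.isBounded.exists_norm_le
    exact ⟨C, fun θ => hC _ ⟨θ, rfl⟩⟩
  have hint : Integrable fun t : ℝ => (1 + t ^ 2)⁻¹ * g (Real.arctan t) :=
    integrable_inv_one_add_sq.mul_bdd (c := C)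
      (hgc.comp Real.continuous_arctan).aestronglyMeasurable (ae_of_all _ fun t => hC _)
  have hderiv : ∀ t, HasDerivAt (fun t => G (Real.arctan t))
      ((1 + t ^ 2)⁻¹ * g (Real.arctan t)) t := fun t => by
    have h := (hG (Real.arctan t)).comp t (Real.hasDerivAt_arctan t)
    exact h.congr_deriv (by rw [one_div, mul_comm])
  have hval := integral_of_hasDerivAt_of_tendsto hderiv hint
    ((hGc.tendsto _).comp (tendsto_nhds_of_tendsto_nhdsWithin Real.tendsto_arctan_atBot))
    ((hGc.tendsto _).comp (tendsto_nhds_of_tendsto_nhdsWithin Real.tendsto_arctan_atTop))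
  unfold lineTension
  simp_rw [hpt]
  rw [hval, norm_sq_eq_add, ← hB, inner_eq_add, ← hα]
  simp only [G, Real.sin_neg, Real.cos_neg, Real.sin_pi_div_two, Real.cos_pi_div_two, etaOf]
  have hν' : (1 - ν) ≠ 0 := by linarith
  rw [hK, hBαβ]
  field_simp
  ring

/-! ### Lower bounds by calibration -/

theorem ENNReal.ofReal_sum_le {ι : Type*} (s : Finset ι) (f : ι → ℝ) :
    ENNReal.ofReal (∑ i ∈ s, f i) ≤ ∑ i ∈ s, ENNReal.ofReal (f i) := by
  classical
  induction s using Finset.induction_on with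
  | empty => simp
  | insert a s ha ih =>
    rw [Finset.sum_insert ha, Finset.sum_insert ha]
    exact ENNReal.ofReal_add_le.trans (by gcongr)

theorem ENNReal.ofReal_integral_le_lintegral_ofReal {α : Type*} [MeasurableSpace α]
    {m : Measure α} {f : α → ℝ} (hf : Integrable f m) :
    ENNReal.ofReal (∫ x, f x ∂m) ≤ ∫⁻ x, ENNReal.ofReal (f x) ∂m := by
  have h : ∫ x, f x ∂m ≤ ∫ x, max (f x) 0 ∂m :=
    integral_mono hf hf.pos_part fun x => le_max_left _ _
  refine (ENNReal.ofReal_le_ofReal h).trans ?_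
  rw [ofReal_integral_eq_lintegral_ofReal hf.pos_part (ae_of_all _ fun x => le_max_right _ _)]
  exact lintegral_mono fun x => by simp [ENNReal.ofReal_max]

/-- The increment of a Lipschitz curve in a direction `p`, bounded by an integral of `|γ'|`. -/
theorem ofReal_inner_sub_le_lintegral {γ : ℝ → Plane} {K : ℝ≥0}
    (hγ : LipschitzOnWith K γ (Set.Icc 0 1)) (p : Plane) (w : ℝ) (F : Plane → ℝ≥0∞)
    (hF : ∀ v, ENNReal.ofReal (w * inner ℝ p v) ≤ F v) :
    ENNReal.ofReal (w * (inner ℝ p (γ 1) - inner ℝ p (γ 0))) ≤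
      ∫⁻ t in Set.Icc (0 : ℝ) 1, F (deriv γ t) := by
  have hu : Set.uIcc (0 : ℝ) 1 = Set.Icc 0 1 := Set.uIcc_of_le zero_le_one
  let g : ℝ → ℝ := fun t => inner ℝ p (γ t)
  have hg : AbsolutelyContinuousOnInterval g 0 1 := by
    have h := (innerSL ℝ p).lipschitz.comp_lipschitzOnWith hγ
    rw [← hu] at h
    exact h.absolutelyContinuousOnInterval
  have hint : IntegrableOn (deriv g) (Set.Icc 0 1) := by
    rw [integrableOn_Icc_iff_integrableOn_Ioc,
      ← intervalIntegrable_iff_integrableOn_Ioc_of_le zero_le_one]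
    exact hg.intervalIntegrable_deriv
  have hftc : ∫ t in Set.Icc (0 : ℝ) 1, deriv g t = g 1 - g 0 := by
    rw [integral_Icc_eq_integral_Ioc, ← intervalIntegral.integral_of_le zero_le_one]
    exact hg.integral_deriv_eq_sub
  -- The two endpoints are discarded, since only one-sided information on `γ` is available there.
  have hdiff : ∀ᵐ t, t ∈ Set.Icc (0 : ℝ) 1 → DifferentiableAt ℝ γ t := by
    have h₁ : ∀ᵐ x : ℝ, x ≠ 0 := by simp [ae_iff, measure_singleton]
    have h₂ : ∀ᵐ x : ℝ, x ≠ 1 := by simp [ae_iff, measure_singleton]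
    filter_upwards [hγ.ae_differentiableWithinAt_of_mem_real, h₁, h₂] with x h h0 h1 hx
    exact (h hx).differentiableAt
      (Icc_mem_nhds (lt_of_le_of_ne hx.1 h0.symm) (lt_of_le_of_ne hx.2 h1))
  calc ENNReal.ofReal (w * (inner ℝ p (γ 1) - inner ℝ p (γ 0)))
      = ENNReal.ofReal (∫ t in Set.Icc (0 : ℝ) 1, w * deriv g t) := by
        rw [integral_const_mul, hftc]
    _ ≤ ∫⁻ t in Set.Icc (0 : ℝ) 1, ENNReal.ofReal (w * deriv g t) :=
        ENNReal.ofReal_integral_le_lintegral_ofReal (hint.const_mul w)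
    _ ≤ ∫⁻ t in Set.Icc (0 : ℝ) 1, F (deriv γ t) := by
        refine lintegral_mono_ae ?_
        rw [ae_restrict_iff' measurableSet_Icc]
        filter_upwards [hdiff] with t ht hmem
        have hd : deriv g t = inner ℝ p (deriv γ t) :=
          ((innerSL ℝ p).hasFDerivAt.comp_hasDerivAt t (ht hmem).hasDerivAt).deriv
        rw [hd]
        exact hF _

namespace DislocationNetwork

/-- Summation by parts: the conservation law is tested against `f` on a finite set containing all
endpoints, the source and the sink. -/
theorem sum_endpoints_of_carries {𝒩 : DislocationNetwork} {b p q : Plane}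
    (h : 𝒩.Carries b p q) (a : Plane →ₗ[ℝ] ℝ) (f : Plane → ℝ) :
    ∑ i, a (ofInt (𝒩.burgers i)) * (f (𝒩.γ i 1) - f (𝒩.γ i 0)) = a b * (f q - f p) := by
  classical
  let S : Finset Plane := Finset.univ.image (fun i => 𝒩.γ i 0) ∪
    Finset.univ.image (fun i => 𝒩.γ i 1) ∪ {p, q}
  have h0 : ∀ i, 𝒩.γ i 0 ∈ S := fun i => by simp [S]
  have h1 : ∀ i, 𝒩.γ i 1 ∈ S := fun i => by simp [S]
  have hp : p ∈ S := by simp [S]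
  have hq : q ∈ S := by simp [S]
  have key : ∑ x ∈ S, a (𝒩.starting x - 𝒩.ending x) * f x =
      ∑ x ∈ S, a ((if x = p then b else 0) - (if x = q then b else 0)) * f x :=
    Finset.sum_congr rfl fun x _ => by rw [h x]
  have hl : ∑ x ∈ S, a (𝒩.starting x - 𝒩.ending x) * f x =
      ∑ i, a (ofInt (𝒩.burgers i)) * (f (𝒩.γ i 0) - f (𝒩.γ i 1)) := by
    simp only [starting, ending, map_sub, map_sum, sub_mul, Finset.sum_mul, Finset.sum_sub_distrib,
      mul_sub]
    congr 1
    · rw [Finset.sum_comm]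
      refine Finset.sum_congr rfl fun i _ => ?_
      rw [Finset.sum_eq_single_of_mem _ (h0 i)]
      · simp
      · intro x _ hx
        simp [Ne.symm hx]
    · rw [Finset.sum_comm]
      refine Finset.sum_congr rfl fun i _ => ?_
      rw [Finset.sum_eq_single_of_mem _ (h1 i)]
      · simp
      · intro x _ hx
        simp [Ne.symm hx]
  have hr : ∑ x ∈ S, a ((if x = p then b else 0) - (if x = q then b else 0)) * f x =
      a b * (f p - f q) := by
    simp only [map_sub, sub_mul, Finset.sum_sub_distrib, mul_sub]
    congr 1
    · rw [Finset.sum_eq_single_of_mem _ hp]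
      · simp
      · intro x _ hx
        simp [hx]
    · rw [Finset.sum_eq_single_of_mem _ hq]
      · simp
      · intro x _ hx
        simp [hx]
  rw [hl, hr] at key
  have : ∑ i, a (ofInt (𝒩.burgers i)) * (f (𝒩.γ i 1) - f (𝒩.γ i 0)) =
      -∑ i, a (ofInt (𝒩.burgers i)) * (f (𝒩.γ i 0) - f (𝒩.γ i 1)) := by
    rw [← Finset.sum_neg_distrib]
    exact Finset.sum_congr rfl fun i _ => by ring
  rw [this, key]
  ring

/-- Lower bound by calibration. -/
theorem ofReal_le_energy_of_calibration {ψ₀ : Plane → Plane → ℝ} (a : Plane →ₗ[ℝ] ℝ) (p : Plane)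
    (hcal : ∀ (b : Fin 2 → ℤ) (v : Plane), v ≠ 0 →
      a (ofInt b) * inner ℝ p v ≤ ψ₀ (ofInt b) (normalOf v) * ‖v‖)
    {𝒩 : DislocationNetwork} {b q : Plane} (h : 𝒩.Carries b 0 q) :
    ENNReal.ofReal (a b * inner ℝ p q) ≤ 𝒩.energy ψ₀ := by
  have hs := sum_endpoints_of_carries h a (fun x => inner ℝ p x)
  rw [inner_zero_right, sub_zero] at hs
  rw [← hs]
  refine (ENNReal.ofReal_sum_le _ _).trans (Finset.sum_le_sum fun i _ => ?_)
  obtain ⟨K, hK⟩ := 𝒩.lipschitz i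
  refine ofReal_inner_sub_le_lintegral hK p _
    (fun v => ENNReal.ofReal (ψ₀ (ofInt (𝒩.burgers i)) (normalOf v)) * ENNReal.ofReal ‖v‖)
    fun v => ?_
  -- Where the curve is stationary the normal is meaningless, but both sides vanish.
  rcases eq_or_ne v 0 with rfl | hv
  · simp
  · rw [← ENNReal.ofReal_mul' (norm_nonneg v)]
    exact ENNReal.ofReal_le_ofReal (hcal _ v hv)

end DislocationNetwork

/-- The calibration bound is linear in the Burgers vector, so the factor `1/s` cancels for every `s
> 0`. -/
theorem ofReal_le_asymptoticLineTension_of_calibration {ψ₀ : Plane → Plane → ℝ}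
    (a : Plane →ₗ[ℝ] ℝ) (p : Plane)
    (hcal : ∀ (b : Fin 2 → ℤ) (v : Plane), v ≠ 0 →
      a (ofInt b) * inner ℝ p v ≤ ψ₀ (ofInt b) (normalOf v) * ‖v‖) (b n : Plane) :
    ENNReal.ofReal (a b * inner ℝ p (perp n)) ≤ asymptoticLineTension ψ₀ b n := by
  refine le_liminf_of_le (by isBoundedDefault) ?_
  filter_upwards [eventually_gt_atTop 0] with s hs
  have h : ENNReal.ofReal (a (s • b) * inner ℝ p (perp n)) ≤ relaxedLineTension ψ₀ (s • b) n :=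
    le_iInf₂ fun 𝒩 h𝒩 => 𝒩.ofReal_le_energy_of_calibration a p hcal h𝒩
  calc ENNReal.ofReal (a b * inner ℝ p (perp n))
      = ENNReal.ofReal (1 / s) * ENNReal.ofReal (a (s • b) * inner ℝ p (perp n)) := by
        rw [← ENNReal.ofReal_mul (by positivity), map_smul, smul_eq_mul]
        congr 1
        field_simp
    _ ≤ _ := by gcongr

/-! ### Upper bounds by a fan of nearly straight arcs -/

namespace Plane

theorem inner_perp_right (n : Plane) : inner ℝ n (perp n) = 0 := by
  rw [inner_eq_add, perp_zero, perp_one]; ring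

theorem normalOf_perp {n : Plane} (hn : ‖n‖ = 1) : normalOf (perp n) = n := by
  unfold normalOf
  rw [norm_perp, hn]
  ext i
  fin_cases i <;> simp

theorem norm_normalOf {v : Plane} (hv : v ≠ 0) : ‖normalOf v‖ = 1 := by
  have h : ‖(!₂[v 1, -(v 0)] : Plane)‖ = ‖v‖ := by
    rw [norm_eq_sqrt, norm_eq_sqrt]
    simp [add_comm]
  rw [normalOf, norm_smul, h, norm_inv, norm_norm, inv_mul_cancel₀ (norm_ne_zero_iff.2 hv)]

theorem perp_normalOf {v : Plane} (hv : v ≠ 0) : ‖v‖ • perp (normalOf v) = v := by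
  have := norm_ne_zero_iff.2 hv
  ext i
  fin_cases i <;> simp [normalOf] <;> field_simp

theorem continuousAt_normalOf {v : Plane} (hv : v ≠ 0) : ContinuousAt normalOf v := by
  refine ContinuousAt.smul (continuous_norm.continuousAt.inv₀ (norm_ne_zero_iff.2 hv)) ?_
  fun_prop

end Plane

/-- The arc `t ↦ t n^⊥ + c t (1 - t) n` of a parabola, which joins `0` to `n^⊥`. -/
def parabolicArc (n : Plane) (c t : ℝ) : Plane := t • perp n + (c * (t * (1 - t))) • n

theorem hasDerivAt_parabolicArc (n : Plane) (c t : ℝ) :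
    HasDerivAt (parabolicArc n c) (perp n + (c * (1 - 2 * t)) • n) t := by
  have h1 : HasDerivAt (fun t : ℝ => c * (t * (1 - t))) (c * (1 - 2 * t)) t := by
    have h := ((hasDerivAt_id t).mul ((hasDerivAt_id t).const_sub 1)).const_mul c
    exact h.congr_deriv (by simp only [id]; ring)
  have h := ((hasDerivAt_id t).smul_const (perp n)).add (h1.smul_const n)
  rw [one_smul] at h
  exact h

theorem lipschitzOnWith_parabolicArc (n : Plane) (c : ℝ) :
    ∃ K : ℝ≥0, LipschitzOnWith K (parabolicArc n c) (Set.Icc 0 1) := by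
  have h : ContDiff ℝ 1 (parabolicArc n c) := by unfold parabolicArc; fun_prop
  exact h.contDiffOn.exists_lipschitzOnWith one_ne_zero (convex_Icc 0 1) isCompact_Icc

theorem parabolicArc_eq_iff {n : Plane} (hn : ‖n‖ = 1) {c d s t : ℝ}
    (h : parabolicArc n c s = parabolicArc n d t) :
    s = t ∧ c * (s * (1 - s)) = d * (t * (1 - t)) := by
  have hnn : inner ℝ n n = (1 : ℝ) := by rw [real_inner_self_eq_norm_sq, hn, one_pow]
  have hpp : inner ℝ (perp n) (perp n) = (1 : ℝ) := by
    rw [real_inner_self_eq_norm_sq, norm_perp, hn, one_pow]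
  have hnp := inner_perp_right n
  have hpn : inner ℝ (perp n) n = (0 : ℝ) := by rw [real_inner_comm, hnp]
  have h1 := congrArg (inner ℝ (perp n)) h
  have h2 := congrArg (inner ℝ n) h
  simp only [parabolicArc, inner_add_right, inner_smul_right, hnn, hpp, hnp, hpn] at h1 h2
  exact ⟨by linarith, by linarith⟩

/-- `m` parabolic arcs from `0` to `n^⊥`, each with Burgers vector `b`. -/
def parabolicFan {n : Plane} (hn : ‖n‖ = 1) {ε : ℝ} (hε : 0 < ε) (m : ℕ) (b : Fin 2 → ℤ) :
    DislocationNetwork where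
  M := m
  γ j := parabolicArc n (ε * (j : ℕ))
  burgers _ := b
  lipschitz _ := lipschitzOnWith_parabolicArc n _
  overlap_null := by
    have := Measure.nullSingletonClass_hausdorff Plane one_pos
    refine measure_mono_null ?_ (Set.Finite.measure_zero (Set.toFinite {0, perp n}) _)
    rintro x ⟨⟨i, s⟩, ⟨j, t⟩, hne, -, -, hx, hy⟩
    obtain ⟨rfl, h⟩ := parabolicArc_eq_iff hn (hx.trans hy.symm)
    dsimp only at hx h
    -- Strictly between the endpoints the height along `n` identifies the arc, so only `0` and `n^⊥`
    -- are covered more than once.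
    rcases eq_or_ne (s * (1 - s)) 0 with hs | hs
    · rcases mul_eq_zero.1 hs with h0 | h1
      · left; rw [← hx, h0]; simp [parabolicArc]
      · right
        obtain rfl : s = 1 := by linarith
        rw [Set.mem_singleton_iff, ← hx]; simp [parabolicArc]
    · have hij := mul_left_cancel₀ hε.ne' (mul_right_cancel₀ hs h)
      exact absurd (by rw [Fin.ext (Nat.cast_injective hij)]) hne

open scoped Classical in
theorem carries_parabolicFan {n : Plane} (hn : ‖n‖ = 1) {ε : ℝ} (hε : 0 < ε) (m : ℕ)
    (b : Fin 2 → ℤ) :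
    (parabolicFan hn hε m b).Carries ((m : ℝ) • ofInt b) 0 (perp n) := by
  intro x
  have h0 : ∀ c, parabolicArc n c 0 = 0 := fun c => by simp [parabolicArc]
  have h1 : ∀ c, parabolicArc n c 1 = perp n := fun c => by simp [parabolicArc]
  have hs : (parabolicFan hn hε m b).starting x =
      ∑ j : Fin m, if parabolicArc n (ε * (j : ℕ)) 0 = x then ofInt b else 0 := rfl
  have he : (parabolicFan hn hε m b).ending x =
      ∑ j : Fin m, if parabolicArc n (ε * (j : ℕ)) 1 = x then ofInt b else 0 := rfl
  simp only [hs, he, h0, h1, Finset.sum_const, Finset.card_fin, ← Nat.cast_smul_eq_nsmul ℝ,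
    smul_ite, smul_zero, @eq_comm _ x]

/-- Upper bound by `m` dislocations near the straight segment. -/
theorem relaxedLineTension_nat_smul_le {ψ₀ : Plane → Plane → ℝ} {n : Plane} (hn : ‖n‖ = 1)
    (b : Fin 2 → ℤ)
    (hψ : ContinuousAt (fun v => ψ₀ (ofInt b) (normalOf v) * ‖v‖) (perp n)) (m : ℕ) :
    relaxedLineTension ψ₀ ((m : ℝ) • ofInt b) n ≤ m * ENNReal.ofReal (ψ₀ (ofInt b) n) := by
  -- The bent arcs need not attain `ψ₀`, so each gets a budget `E` that finally decreases to it.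
  have key : ∀ E, ψ₀ (ofInt b) n < E →
      relaxedLineTension ψ₀ ((m : ℝ) • ofInt b) n ≤ m * ENNReal.ofReal E := by
    intro E hE
    have hE' : ψ₀ (ofInt b) (normalOf (perp n)) * ‖perp n‖ < E := by
      rwa [normalOf_perp hn, norm_perp, hn, mul_one]
    obtain ⟨τ, hτ, hball⟩ := Metric.eventually_nhds_iff.1 (hψ.eventually_lt_const hE')
    have hm : (0 : ℝ) < m + 1 := by positivity
    -- With this spacing, all `m` arcs have velocity within `τ` of `n^⊥`.
    have hε : 0 < τ / (m + 1) := by positivity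
    refine iInf₂_le_of_le (parabolicFan hn hε m b) (carries_parabolicFan hn hε m b) ?_
    have hcurve : ∀ j : Fin m, (∫⁻ t in Set.Icc (0 : ℝ) 1,
        ENNReal.ofReal (ψ₀ (ofInt b)
          (normalOf (deriv (parabolicArc n (τ / (m + 1) * (j : ℕ))) t)))
        * ENNReal.ofReal ‖deriv (parabolicArc n (τ / (m + 1) * (j : ℕ))) t‖) ≤
        ENNReal.ofReal E := by
      intro j
      calc _ ≤ ∫⁻ t in Set.Icc (0 : ℝ) 1, ENNReal.ofReal E := by
            refine setLIntegral_mono measurable_const fun t ht => ?_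
            rw [(hasDerivAt_parabolicArc n _ t).deriv, ← ENNReal.ofReal_mul' (norm_nonneg _)]
            refine ENNReal.ofReal_le_ofReal (hball ?_).le
            rw [dist_eq_norm, add_sub_cancel_left, norm_smul, hn, mul_one, Real.norm_eq_abs,
              abs_mul, abs_of_nonneg (by positivity)]
            have hj : ((j : ℕ) : ℝ) < m + 1 := by
              have : ((j : ℕ) : ℝ) < m := Nat.cast_lt.2 j.2
              linarith
            have ht' : |1 - 2 * t| ≤ 1 := abs_le.2 ⟨by linarith [ht.2], by linarith [ht.1]⟩
            calc τ / (m + 1) * (j : ℕ) * |1 - 2 * t| ≤ τ / (m + 1) * (j : ℕ) * 1 := by gcongr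
              _ < τ / (m + 1) * (m + 1) := by rw [mul_one]; gcongr
              _ = τ := by field_simp
        _ = ENNReal.ofReal E := by simp
    calc (parabolicFan hn hε m b).energy ψ₀ ≤ ∑ _j : Fin m, ENNReal.ofReal E :=
          Finset.sum_le_sum fun j _ => hcurve j
      _ = m * ENNReal.ofReal E := by simp
  have hlim : Tendsto (fun E => (m : ℝ≥0∞) * ENNReal.ofReal E) (𝓝[>] (ψ₀ (ofInt b) n))
      (𝓝 (m * ENNReal.ofReal (ψ₀ (ofInt b) n))) :=
    (ENNReal.Tendsto.const_mul (ENNReal.continuous_ofReal.tendsto _)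
      (Or.inr (ENNReal.natCast_ne_top m))).mono_left nhdsWithin_le_nhds
  exact ge_of_tendsto hlim (by filter_upwards [self_mem_nhdsWithin] with E hE using key E hE)

/-- A liminf is bounded along a sequence: `s = m / k` makes the Burgers vector an integer multiple
of `b`. For `k = 0` the empty fan serves. -/
theorem asymptoticLineTension_smul_le_of_nonneg {ψ₀ : Plane → Plane → ℝ} {n : Plane}
    (hn : ‖n‖ = 1) (b : Fin 2 → ℤ)
    (hψ : ContinuousAt (fun v => ψ₀ (ofInt b) (normalOf v) * ‖v‖) (perp n)) {k : ℝ}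
    (hk : 0 ≤ k) :
    asymptoticLineTension ψ₀ (k • ofInt b) n ≤ ENNReal.ofReal (k * ψ₀ (ofInt b) n) := by
  have hle : ∀ (s : ℝ) (m : ℕ), 0 < s → s * k = m →
      ENNReal.ofReal (1 / s) * relaxedLineTension ψ₀ (s • k • ofInt b) n ≤
        ENNReal.ofReal (k * ψ₀ (ofInt b) n) := by
    intro s m hs hm
    rw [smul_smul, hm]
    calc _ ≤ ENNReal.ofReal (1 / s) * (m * ENNReal.ofReal (ψ₀ (ofInt b) n)) := by
          gcongr
          exact relaxedLineTension_nat_smul_le hn b hψ m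
      _ = ENNReal.ofReal (k * ψ₀ (ofInt b) n) := by
          rw [← ENNReal.ofReal_natCast m, ← ENNReal.ofReal_mul (by positivity),
            ← ENNReal.ofReal_mul (by positivity), ← hm]
          congr 1
          field_simp
  refine liminf_le_of_frequently_le' (frequently_atTop.2 fun A => ?_)
  rcases hk.eq_or_lt with rfl | hk'
  · exact ⟨max A 1, le_max_left _ _, hle _ 0 (by positivity) (by simp)⟩
  · obtain ⟨m, hm⟩ := exists_nat_gt (max A 1 * k)
    have h := (lt_div_iff₀ hk').2 hm
    exact ⟨m / k, (le_max_left _ _).trans h.le,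
      hle _ m (lt_of_lt_of_le (by positivity) h.le) (by field_simp)⟩

/-! ### Both bounds for the cubic kernel -/

theorem etaOf_mem {ν : ℝ} (h₁ : -1 < ν) (h₂ : ν < 1 / 2) : -(1 / 2) ≤ etaOf ν ∧ etaOf ν ≤ 1 := by
  have h : 0 < 1 - ν := by linarith
  unfold etaOf
  exact ⟨by rw [le_div_iff₀ h]; linarith, by rw [div_le_iff₀ h]; linarith⟩

theorem etaOf_nonneg {ν : ℝ} (h₁ : 0 ≤ ν) (h₂ : ν < 1 / 2) : 0 ≤ etaOf ν :=
  div_nonneg h₁ (by linarith)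

theorem continuousAt_lineTension_cubicKernel (μ : ℝ) {ν : ℝ} (hν : ν < 1) (b : Plane) {v : Plane}
    (hv : v ≠ 0) :
    ContinuousAt (fun v => lineTension (cubicKernel μ ν) b (normalOf v) * ‖v‖) v := by
  have hcont : ContinuousAt (fun v => μ / (4 * Real.pi) *
      (‖b‖ ^ 2 + etaOf ν * (inner ℝ b (normalOf v)) ^ 2) * ‖v‖) v := by
    have h : ContinuousAt (fun v => (inner ℝ b (normalOf v) : ℝ)) v :=
      (innerSL ℝ b).continuous.continuousAt.comp (continuousAt_normalOf hv)
    exact (continuousAt_const.mul (continuousAt_const.add (continuousAt_const.mul (h.pow 2)))).mul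
      continuous_norm.continuousAt
  refine hcont.congr ?_
  filter_upwards [isOpen_ne.mem_nhds hv] with w hw
  rw [lineTension_cubicKernel hν b (norm_normalOf hw)]

theorem psiInfCubic_smul_le (μ : ℝ) {ν : ℝ} (hν : ν < 1) (b : Fin 2 → ℤ) (k : ℝ) {n : Plane}
    (hn : ‖n‖ = 1) :
    psiInfCubic μ ν (k • ofInt b) n ≤ ENNReal.ofReal
      (|k| * (μ / (4 * Real.pi) * (‖ofInt b‖ ^ 2 + etaOf ν * (inner ℝ (ofInt b) n) ^ 2))) := by
  have hp : perp n ≠ 0 := by rw [← norm_ne_zero_iff, norm_perp, hn]; exact one_ne_zero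
  have h : ∀ (b : Fin 2 → ℤ) {k : ℝ}, 0 ≤ k → psiInfCubic μ ν (k • ofInt b) n ≤ ENNReal.ofReal
      (k * (μ / (4 * Real.pi) * (‖ofInt b‖ ^ 2 + etaOf ν * (inner ℝ (ofInt b) n) ^ 2))) := by
    intro b k hk
    have := asymptoticLineTension_smul_le_of_nonneg hn b
      (continuousAt_lineTension_cubicKernel μ hν (ofInt b) hp) hk
    rwa [lineTension_cubicKernel hν _ hn] at this
  -- The energy is even in `b`, so a negative `k` is absorbed by reversing `b`.
  have hneg : ofInt (-b) = -ofInt b := by ext i; simp [ofInt]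
  rcases le_total 0 k with hk | hk
  · rw [abs_of_nonneg hk]
    exact h b hk
  · rw [abs_of_nonpos hk]
    have := h (-b) (neg_nonneg.2 hk)
    rwa [hneg, smul_neg, neg_smul, neg_neg, norm_neg, inner_neg_left, neg_sq] at this

theorem Plane.inner_perp_perp (v w : Plane) : inner ℝ (perp v) (perp w) = (inner ℝ v w : ℝ) := by
  simp only [inner_eq_add, perp_zero, perp_one]; ring

/-- Rotating by a right angle turns a calibration condition on tangents into one on unit normals. -/
theorem le_psiInfCubic {μ ν : ℝ} (hν : ν < 1) (a : Plane →ₗ[ℝ] ℝ) (p : Plane)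
    (hcal : ∀ (b : Fin 2 → ℤ) (m : Plane), ‖m‖ = 1 → a (ofInt b) * inner ℝ p m ≤
      μ / (4 * Real.pi) * (‖ofInt b‖ ^ 2 + etaOf ν * (inner ℝ (ofInt b) m) ^ 2))
    (b n : Plane) :
    ENNReal.ofReal (a b * inner ℝ p n) ≤ psiInfCubic μ ν b n := by
  rw [← inner_perp_perp]
  refine ofReal_le_asymptoticLineTension_of_calibration a (perp p) (fun b v hv => ?_) b n
  have hm := norm_normalOf hv
  rw [lineTension_cubicKernel hν _ hm]
  have hv' : inner ℝ (perp p) v = ‖v‖ * inner ℝ p (normalOf v) := by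
    conv_lhs => rw [← perp_normalOf hv]
    rw [inner_smul_right, inner_perp_perp]
  rw [hv']
  calc _ = a (ofInt b) * inner ℝ p (normalOf v) * ‖v‖ := by ring
    _ ≤ _ := mul_le_mul_of_nonneg_right (hcal b _ hm) (norm_nonneg v)

/-! ### The calibration inequalities -/

/-- The tangent line inequality for the line tension of a basis vector. -/
theorem tangent_le_one_add {c s x y η : ℝ} (h₁ : c ^ 2 + s ^ 2 = 1) (h₂ : x ^ 2 + y ^ 2 = 1)
    (hη : -(1 / 2) ≤ η) (hη' : η ≤ 1) :
    (c * x + s * y) * (1 - η * s ^ 2) + 2 * η * s * y ≤ 1 + η * y ^ 2 := by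
  -- For unit vectors at angles `φ` and `θ`, `q` and `r` are the cosine and sine of `θ - φ`, and `X`
  -- below is `cos (θ + φ)`.
  obtain ⟨q, hq⟩ : ∃ q, q = c * x + s * y := ⟨_, rfl⟩
  obtain ⟨r, hr⟩ : ∃ r, r = c * y - s * x := ⟨_, rfl⟩
  have hqr : q ^ 2 + r ^ 2 = 1 := by
    rw [hq, hr]; linear_combination (x ^ 2 + y ^ 2) * h₁ + h₂
  have hy : y = s * q + c * r := by rw [hq, hr]; linear_combination (-y) * h₁
  obtain ⟨X, hX⟩ : ∃ X, X = (c ^ 2 - s ^ 2) * q - 2 * s * c * r := ⟨_, rfl⟩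
  have hX2 : X ^ 2 + ((c ^ 2 - s ^ 2) * r + 2 * s * c * q) ^ 2 = 1 := by
    rw [hX]
    linear_combination (c ^ 2 + s ^ 2) ^ 2 * hqr + (c ^ 2 + s ^ 2 + 1) * h₁
  have hXabs : |X| ≤ 1 := by
    rw [← sq_le_one_iff_abs_le_one]; nlinarith [sq_nonneg ((c ^ 2 - s ^ 2) * r + 2 * s * c * q)]
  have hqabs : |q| ≤ 1 := by rw [← sq_le_one_iff_abs_le_one]; nlinarith [sq_nonneg r]
  -- The gap in the inequality is `(1 - q)` times this factor. As `c² + X` lies in `[-1, 2]`, the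
  -- bounds `η ≤ 1` and `η ≥ -1/2` are what is needed.
  have hZ : 0 ≤ 1 + η * (c ^ 2 + X) := by
    have hlow : -1 ≤ c ^ 2 + X := by linarith [(abs_le.1 hXabs).1, sq_nonneg c]
    have hup : c ^ 2 + X ≤ 2 := by linarith [(abs_le.1 hXabs).2, sq_nonneg s]
    rcases le_total 0 η with h | h
    · nlinarith
    · nlinarith
  have hprod := mul_nonneg (sub_nonneg.2 (abs_le.1 hqabs).2) hZ
  have hid : 1 + η * y ^ 2 - (q * (1 - η * s ^ 2) + 2 * η * s * y)
      = (1 - q) * (1 + η * (c ^ 2 + X)) := by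
    rw [hX, hy]; linear_combination (η * c ^ 2) * hqr
  rw [← hq]
  linarith

theorem abs_tangent_le_one_add {c s x y η : ℝ} (h₁ : c ^ 2 + s ^ 2 = 1) (h₂ : x ^ 2 + y ^ 2 = 1)
    (hη : -(1 / 2) ≤ η) (hη' : η ≤ 1) :
    |(c * x + s * y) * (1 - η * s ^ 2) + 2 * η * s * y| ≤ 1 + η * y ^ 2 := by
  refine abs_le.2 ⟨?_, tangent_le_one_add h₁ h₂ hη hη'⟩
  have := tangent_le_one_add (x := -x) (y := -y) h₁ (by rw [neg_sq, neg_sq, h₂]) hη hη'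
  rw [neg_sq] at this
  linarith

theorem Int.cast_abs_le_cast_sq (a : ℤ) : |(a : ℝ)| ≤ (a : ℝ) ^ 2 := by
  exact_mod_cast (Int.le_self_sq |a|).trans_eq (sq_abs a)

/-- A second Burgers component cannot lower the cost: if nonzero it contributes `b² ≥ 1`, so `2|a| ≤
a² + b²`. This suffices for `η ≥ 0`, since `1 + η y² ≤ 2`, and for `η ≤ 0`, since at most half of
`a² + b²` is lost. -/
theorem abs_mul_one_add_le {η x y : ℝ} (a b : ℤ) (h : x ^ 2 + y ^ 2 = 1)
    (hη : -(1 / 2) ≤ η) (hη' : η ≤ 1) :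
    |(a : ℝ)| * (1 + η * y ^ 2) ≤ (a : ℝ) ^ 2 + (b : ℝ) ^ 2 + η * (b * x + a * y) ^ 2 := by
  have hy : y ^ 2 ≤ 1 := by linarith [sq_nonneg x]
  have hy0 := sq_nonneg y
  have ha := Int.cast_abs_le_cast_sq a
  have ha0 := abs_nonneg (a : ℝ)
  have hpos : 0 ≤ 1 + η * y ^ 2 := by nlinarith
  have haa : 2 * |(a : ℝ)| ≤ (a : ℝ) ^ 2 + 1 := by
    nlinarith [sq_nonneg (|(a : ℝ)| - 1), sq_abs (a : ℝ)]
  rcases eq_or_ne b 0 with rfl | hb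
  · have := mul_le_mul_of_nonneg_right ha hpos
    push_cast
    linarith
  · have hb1 : (1 : ℝ) ≤ (b : ℝ) ^ 2 := by
      have : 0 < b ^ 2 := by positivity
      exact_mod_cast this
    rcases le_total 0 η with h0 | h0
    · have h1 : |(a : ℝ)| * (1 + η * y ^ 2) ≤ |(a : ℝ)| * 2 := by
        gcongr; nlinarith
      have h2 : 0 ≤ η * (b * x + a * y) ^ 2 := by positivity
      linarith
    · have h1 : |(a : ℝ)| * (1 + η * y ^ 2) ≤ |(a : ℝ)| := by
        have : η * y ^ 2 ≤ 0 := mul_nonpos_of_nonpos_of_nonneg h0 hy0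
        nlinarith
      have hcs : (b * x + a * y) ^ 2 ≤ (a : ℝ) ^ 2 + (b : ℝ) ^ 2 := by
        have : (b * x + a * y) ^ 2 + (a * x - b * y) ^ 2 = (a : ℝ) ^ 2 + (b : ℝ) ^ 2 := by
          linear_combination ((a : ℝ) ^ 2 + (b : ℝ) ^ 2) * h
        linarith [sq_nonneg (a * x - b * y)]
      have h2 : -(1 / 2) * ((a : ℝ) ^ 2 + (b : ℝ) ^ 2) ≤ η * (b * x + a * y) ^ 2 := by
        have h3 := mul_le_mul_of_nonpos_left hcs h0
        have h4 : -(1 / 2) * ((a : ℝ) ^ 2 + (b : ℝ) ^ 2) ≤ η * ((a : ℝ) ^ 2 + (b : ℝ) ^ 2) := by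
          gcongr
        linarith
      linarith

/-! ### The values of `ψ_∞` -/

theorem exists_mul_eq_abs (k : ℝ) : ∃ σ : ℝ, |σ| = 1 ∧ σ * k = |k| := by
  rcases le_total 0 k with h | h
  · exact ⟨1, abs_one, by rw [one_mul, abs_of_nonneg h]⟩
  · exact ⟨-1, by simp, by rw [neg_one_mul, abs_of_nonpos h]⟩

theorem Plane.norm_e (i : Fin 2) : ‖e i‖ = 1 := by simp [e]

theorem Plane.ofInt_single (i : Fin 2) : ofInt (Pi.single i 1) = e i := by
  ext j
  fin_cases i <;> fin_cases j <;> simp [ofInt, e]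

theorem Plane.inner_e (n : Plane) (i : Fin 2) : inner ℝ n (e i) = n i := by
  fin_cases i <;> simp [inner_eq_add, e]

theorem psiInfCubic_smul_e {μ ν : ℝ} (hμ : 0 < μ) (hν : -1 < ν) (hν' : ν < 1 / 2) (i : Fin 2)
    (k : ℝ) {n : Plane} (hn : ‖n‖ = 1) :
    psiInfCubic μ ν (k • e i) n =
      ENNReal.ofReal (μ / (4 * Real.pi) * |k| * (1 + etaOf ν * (inner ℝ n (e i)) ^ 2)) := by
  have hν1 : ν < 1 := by linarith
  obtain ⟨hη, hη'⟩ := etaOf_mem hν hν'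
  set η := etaOf ν
  have hc : 0 < μ / (4 * Real.pi) := by positivity
  set c := μ / (4 * Real.pi)
  apply le_antisymm
  · have h := psiInfCubic_smul_le μ hν1 (Pi.single i 1) k hn
    rw [ofInt_single, norm_e, real_inner_comm] at h
    refine h.trans_eq (congrArg _ ?_)
    ring
  · obtain ⟨σ, hσ, hk⟩ := exists_mul_eq_abs k
    let a : Plane →ₗ[ℝ] ℝ := σ • (EuclideanSpace.proj i : Plane →L[ℝ] ℝ).toLinearMap
    have ha : ∀ v, a v = σ * v i := fun v => rfl
    -- The gradient at `n` of `c (|m| + η m_i² / |m|)`; hence the calibration is sharp at `m = n`.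
    let p : Plane := c • ((1 - η * n i ^ 2) • n + (2 * η * n i) • e i)
    have hp : ∀ m, inner ℝ p m = c * (inner ℝ n m * (1 - η * n i ^ 2) + 2 * η * n i * m i) := by
      intro m
      simp only [p, inner_smul_left, inner_add_left, real_inner_comm m (e i), inner_e]
      simp only [RCLike.conj_to_real]
      ring
    have hcal : ∀ (b : Fin 2 → ℤ) (m : Plane), ‖m‖ = 1 → a (ofInt b) * inner ℝ p m ≤
        c * (‖ofInt b‖ ^ 2 + η * (inner ℝ (ofInt b) m) ^ 2) := by
      intro b m hm
      have hn2 := sq_add_sq_of_norm_eq_one hn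
      have hm2 := sq_add_sq_of_norm_eq_one hm
      rw [ha, hp, norm_sq_eq_add, inner_eq_add, inner_eq_add]
      set T := (n 0 * m 0 + n 1 * m 1) * (1 - η * n i ^ 2) + 2 * η * n i * m i with hT
      have hTle : |T| ≤ 1 + η * m i ^ 2 := by
        fin_cases i
        · have := abs_tangent_le_one_add (add_comm _ _ |>.trans hn2) (add_comm _ _ |>.trans hm2)
            hη hη'
          rwa [add_comm (n 1 * m 1)] at this
        · exact abs_tangent_le_one_add hn2 hm2 hη hη'
      have hb : |(b i : ℝ)| * (1 + η * m i ^ 2) ≤ (b 0 : ℝ) ^ 2 + (b 1 : ℝ) ^ 2 +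
          η * (b 0 * m 0 + b 1 * m 1) ^ 2 := by
        fin_cases i
        · have := abs_mul_one_add_le (b 0) (b 1) (add_comm _ _ |>.trans hm2) hη hη'
          rwa [add_comm ((b 1 : ℝ) * m 1)] at this
        · have := abs_mul_one_add_le (b 1) (b 0) hm2 hη hη'
          rwa [add_comm ((b 1 : ℝ) ^ 2)] at this
      have hbT : σ * b i * T ≤ |(b i : ℝ)| * (1 + η * m i ^ 2) := by
        calc σ * b i * T ≤ |σ * b i * T| := le_abs_self _
          _ = |(b i : ℝ)| * |T| := by rw [abs_mul, abs_mul, hσ, one_mul]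
          _ ≤ _ := by gcongr
      calc σ * b i * (c * T) = c * (σ * b i * T) := by ring
        _ ≤ c * _ := mul_le_mul_of_nonneg_left (hbT.trans hb) hc.le
    have h := le_psiInfCubic hν1 a p hcal (k • e i) n
    rw [ha, hp, real_inner_self_eq_norm_sq, hn] at h
    refine le_trans (le_of_eq (congrArg _ ?_)) h
    have hke : (k • e i) i = k := by simp [e]
    rw [hke, hk, inner_e]
    ring

theorem norm_diagNormal : ‖diagNormal‖ = 1 := by
  have h0 : diagNormal 0 = 1 / √2 := by simp [diagNormal, e]
  have h1 : diagNormal 1 = -(1 / √2) := by simp [diagNormal, e]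
  rw [norm_eq_sqrt, h0, h1, neg_sq, div_pow, Real.sq_sqrt zero_le_two]
  norm_num

/-- The normal is orthogonal to `e₁ + e₂`, so the `η`-term vanishes in the upper bound; for `η ≥ 0`
it may be dropped in the lower one, where `|b₁ + b₂| ≤ b₁² + b₂²` on integers. -/
theorem psiInfCubic_smul_diag {μ ν : ℝ} (hμ : 0 < μ) (hν : 0 ≤ ν) (hν' : ν < 1 / 2) (k : ℝ) :
    psiInfCubic μ ν (k • (e 0 + e 1)) diagNormal =
      ENNReal.ofReal (μ / (4 * Real.pi) * (2 * |k|)) := by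
  have hν1 : ν < 1 := by linarith
  have hη := etaOf_nonneg hν hν'
  have hc : 0 < μ / (4 * Real.pi) := by positivity
  set c := μ / (4 * Real.pi)
  have h0 : diagNormal 0 = 1 / √2 := by simp [diagNormal, e]
  have h1 : diagNormal 1 = -(1 / √2) := by simp [diagNormal, e]
  have hb : ofInt (fun _ => 1) = e 0 + e 1 := by
    ext i; fin_cases i <;> simp [ofInt, e]
  apply le_antisymm
  · have h := psiInfCubic_smul_le μ hν1 (fun _ => 1) k norm_diagNormal
    refine (hb ▸ h).trans_eq (congrArg _ ?_)
    have he0 : (e 0 + e 1 : Plane) 0 = 1 := by simp [e]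
    have he1 : (e 0 + e 1 : Plane) 1 = 1 := by simp [e]
    rw [norm_sq_eq_add, inner_eq_add, h0, h1, he0, he1]
    ring
  · obtain ⟨σ, hσ, hk⟩ := exists_mul_eq_abs k
    let a : Plane →ₗ[ℝ] ℝ := σ • ((EuclideanSpace.proj 0 : Plane →L[ℝ] ℝ).toLinearMap +
      (EuclideanSpace.proj 1 : Plane →L[ℝ] ℝ).toLinearMap)
    have ha : ∀ v, a v = σ * (v 0 + v 1) := fun v => rfl
    have hcal : ∀ (b : Fin 2 → ℤ) (m : Plane), ‖m‖ = 1 → a (ofInt b) * inner ℝ (c • diagNormal) m ≤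
        c * (‖ofInt b‖ ^ 2 + etaOf ν * (inner ℝ (ofInt b) m) ^ 2) := by
      intro b m hm
      have hD : |(inner ℝ diagNormal m : ℝ)| ≤ 1 := by
        have := abs_real_inner_le_norm diagNormal m
        rwa [norm_diagNormal, hm, one_mul] at this
      rw [ha, inner_smul_left, RCLike.conj_to_real, norm_sq_eq_add]
      have hbb : |(b 0 + b 1 : ℝ)| ≤ (b 0 : ℝ) ^ 2 + (b 1 : ℝ) ^ 2 :=
        (abs_add_le _ _).trans
          (add_le_add (Int.cast_abs_le_cast_sq _) (Int.cast_abs_le_cast_sq _))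
      have hle : σ * (b 0 + b 1) * inner ℝ diagNormal m ≤ (b 0 : ℝ) ^ 2 + (b 1 : ℝ) ^ 2 := by
        calc _ ≤ |σ * (b 0 + b 1) * inner ℝ diagNormal m| := le_abs_self _
          _ = |(b 0 + b 1 : ℝ)| * |(inner ℝ diagNormal m : ℝ)| := by
            rw [abs_mul, abs_mul, hσ, one_mul]
          _ ≤ |(b 0 + b 1 : ℝ)| * 1 := by gcongr
          _ ≤ _ := by rwa [mul_one]
      have hpos : 0 ≤ etaOf ν * (inner ℝ (ofInt b) m) ^ 2 := by positivity
      calc σ * (b 0 + b 1) * (c * inner ℝ diagNormal m)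
          = c * (σ * (b 0 + b 1) * inner ℝ diagNormal m) := by ring
        _ ≤ c * ((b 0 : ℝ) ^ 2 + (b 1 : ℝ) ^ 2 + _) :=
          mul_le_mul_of_nonneg_left (by linarith) hc.le
    have h := le_psiInfCubic hν1 a (c • diagNormal) hcal (k • (e 0 + e 1)) diagNormal
    rw [ha, inner_smul_left, real_inner_self_eq_norm_sq, norm_diagNormal,
      RCLike.conj_to_real] at h
    refine le_trans (le_of_eq (congrArg _ ?_)) h
    have hk0 : (k • (e 0 + e 1)) 0 = k := by simp [e]
    have hk1 : (k • (e 0 + e 1)) 1 = k := by simp [e]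
    rw [hk0, hk1, mul_add, hk]
    ring

/-! ### The zig-zag network against the square grid -/

theorem zigzagEnergy_eq {μ ν σ δ : ℝ} (hμ : 0 < μ) (hν : 0 ≤ ν) (hν' : ν < 1 / 2) (hσ : 0 < σ)
    (hδ : 0 ≤ δ) (hδσ : 2 * δ < σ) :
    zigzagEnergy μ ν σ δ = ENNReal.ofReal (4 * σ * (μ / (4 * Real.pi)) *
      (√(δ ^ 2 + (σ / 2 - δ) ^ 2)
        + etaOf ν * ((σ / 2 - δ) ^ 2 / √(δ ^ 2 + (σ / 2 - δ) ^ 2)) + δ * √2)) := by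
  have hη := etaOf_nonneg hν hν'
  have hd : 0 < σ / 2 - δ := by linarith
  have hl : 0 < √(δ ^ 2 + (σ / 2 - δ) ^ 2) := Real.sqrt_pos.2 (by positivity)
  have hl2 : √(δ ^ 2 + (σ / 2 - δ) ^ 2) ^ 2 = δ ^ 2 + (σ / 2 - δ) ^ 2 :=
    Real.sq_sqrt (by positivity)
  unfold zigzagEnergy
  dsimp only
  set l := √(δ ^ 2 + (σ / 2 - δ) ^ 2)
  set d := σ / 2 - δ
  have hn₁ : ‖((1 / l) • !₂[d, δ] : Plane)‖ = 1 := by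
    rw [norm_eq_sqrt, Real.sqrt_eq_one]
    simp only [PiLp.smul_apply, smul_eq_mul, Matrix.cons_val_zero,
      Matrix.cons_val_one, Matrix.cons_val_fin_one]
    field_simp
    linarith
  have hn₂ : ‖((1 / l) • !₂[δ, d] : Plane)‖ = 1 := by
    rw [norm_eq_sqrt, Real.sqrt_eq_one]
    simp only [PiLp.smul_apply, smul_eq_mul, Matrix.cons_val_zero,
      Matrix.cons_val_one, Matrix.cons_val_fin_one]
    field_simp
    linarith
  have hi₁ : inner ℝ ((1 / l) • !₂[d, δ] : Plane) (e 0) = d / l := by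
    rw [inner_e]; simp; ring
  have hi₂ : inner ℝ ((1 / l) • !₂[δ, d] : Plane) (e 1) = d / l := by
    rw [inner_e]; simp; ring
  rw [psiInfCubic_smul_diag hμ hν hν', psiInfCubic_smul_e hμ (by linarith) hν' 0 σ hn₁,
    psiInfCubic_smul_e hμ (by linarith) hν' 1 σ hn₂, hi₁, hi₂, abs_of_pos hσ,
    ← ENNReal.ofReal_add (by positivity) (by positivity), ← ENNReal.ofReal_mul (by positivity),
    ← ENNReal.ofReal_mul (by positivity), ← ENNReal.ofReal_add (by positivity) (by positivity)]
  congr 1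
  field_simp
  ring

theorem zigzagEnergy_zero (μ ν : ℝ) {σ : ℝ} (hσ : 0 < σ) :
    zigzagEnergy μ ν σ 0 = squareGridEnergy μ ν σ := by
  have hl : √((0 : ℝ) ^ 2 + (σ / 2 - 0) ^ 2) = σ / 2 := by
    rw [sub_zero, zero_pow two_ne_zero, zero_add, Real.sqrt_sq (by positivity)]
  have h₁ : ((1 / (σ / 2)) • !₂[σ / 2 - 0, 0] : Plane) = e 0 := by
    ext i; fin_cases i <;> simp [e, hσ.ne']
  have h₂ : ((1 / (σ / 2)) • !₂[0, σ / 2 - 0] : Plane) = e 1 := by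
    ext i; fin_cases i <;> simp [e, hσ.ne']
  unfold zigzagEnergy squareGridEnergy
  dsimp only
  rw [hl, h₁, h₂, mul_zero, zero_mul, ENNReal.ofReal_zero, zero_mul, zero_add,
    mul_div_cancel₀ σ two_ne_zero, mul_add]

/-- The second-order expansion of the length of a zig-zag segment, in a cell of size one. -/
theorem exists_zigzag_expansion {η x : ℝ} (hη : 0 ≤ η) (hη' : η ≤ 1)
    (hx' : 2 * x < 1) :
    ∃ r : ℝ, |r| ≤ 12 * x ^ 2 ∧
      √(x ^ 2 + (1 / 2 - x) ^ 2) + η * ((1 / 2 - x) ^ 2 / √(x ^ 2 + (1 / 2 - x) ^ 2)) + x * √2 =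
        (1 + η) / 2 + x * (√2 - 1 - η) + r := by
  have hd : 0 < 1 / 2 - x := by linarith
  have hl2 : √(x ^ 2 + (1 / 2 - x) ^ 2) ^ 2 = x ^ 2 + (1 / 2 - x) ^ 2 :=
    Real.sq_sqrt (by positivity)
  -- The radicand is `2 (x - 1/4)² + 1/8`; a uniform lower bound makes the error constant universal.
  have hquarter : 1 / 4 ≤ √(x ^ 2 + (1 / 2 - x) ^ 2) :=
    Real.le_sqrt_of_sq_le (by nlinarith [sq_nonneg (x - 1 / 4)])
  set l := √(x ^ 2 + (1 / 2 - x) ^ 2)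
  have hl : 0 < l := by linarith
  have hA : l - (1 / 2 - x) = x ^ 2 / (l + (1 / 2 - x)) := by
    rw [eq_div_iff (by positivity)]; linear_combination hl2
  have hB : (1 / 2 - x) ^ 2 / l = l - x ^ 2 / l := by
    rw [eq_sub_iff_add_eq, ← add_div, div_eq_iff hl.ne']; linear_combination -hl2
  have h4 : x ^ 2 / l ≤ 4 * x ^ 2 := by
    rw [div_le_iff₀ hl]; nlinarith [sq_nonneg x]
  have h4' : x ^ 2 / (l + (1 / 2 - x)) ≤ 4 * x ^ 2 :=
    (div_le_div_of_nonneg_left (sq_nonneg x) hl (by linarith)).trans h4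
  have h0 : 0 ≤ x ^ 2 / l := by positivity
  have h0' : 0 ≤ x ^ 2 / (l + (1 / 2 - x)) := by positivity
  -- Both quadratic quantities lie in `[0, 4x²]` and `η ≤ 1`, so the constant 12 leaves room.
  refine ⟨(1 + η) * (l - (1 / 2 - x)) - η * (x ^ 2 / l), ?_, ?_⟩
  · rw [hA, abs_le]
    constructor <;> nlinarith
  · rw [hB]; ring

theorem exists_toReal_zigzagEnergy_eq {μ ν σ δ : ℝ} (hμ : 0 < μ) (hν : 0 ≤ ν) (hν' : ν < 1 / 2)
    (hσ : 0 < σ) (hδ : 0 ≤ δ) (hδσ : 2 * δ < σ) :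
    ∃ r : ℝ, |r| ≤ 12 * (δ / σ) ^ 2 ∧
      (zigzagEnergy μ ν σ δ).toReal = 4 * σ ^ 2 * (μ / (4 * Real.pi)) *
        ((1 + etaOf ν) / 2 + δ / σ * (√2 - 1 - etaOf ν) + r) := by
  have hη := etaOf_nonneg hν hν'
  have hη' := (etaOf_mem (by linarith) hν').2
  obtain ⟨r, hr, h⟩ := exists_zigzag_expansion hη hη' (x := δ / σ)
    (by rw [← mul_div_assoc, div_lt_one hσ]; exact hδσ)
  have hl : √(δ ^ 2 + (σ / 2 - δ) ^ 2) = σ * √((δ / σ) ^ 2 + (1 / 2 - δ / σ) ^ 2) := by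
    rw [← Real.sqrt_sq hσ.le, ← Real.sqrt_mul (sq_nonneg σ), Real.sqrt_sq hσ.le]
    congr 1
    field_simp
  refine ⟨r, hr, ?_⟩
  rw [zigzagEnergy_eq hμ hν hν' hσ hδ hδσ, ENNReal.toReal_ofReal (by positivity), ← h, hl]
  field_simp

theorem sqrt_two_sub_one_lt_etaOf_iff {ν : ℝ} (hν : ν < 1 / 2) :
    √2 - 1 < etaOf ν ↔ 1 - 1 / √2 < ν := by
  have h2 : √2 * √2 = 2 := Real.mul_self_sqrt zero_le_two
  have hs : 0 < √2 := Real.sqrt_pos.2 zero_lt_two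
  have h : 1 - 1 / √2 = (√2 - 1) / √2 := by field_simp
  rw [etaOf, lt_div_iff₀ (by linarith), h, div_lt_iff₀ hs]
  constructor <;> intro h <;> linarith

theorem exists_zigzagEnergy_lt {ν : ℝ} (hν : ν < 1 / 2) (hη : √2 - 1 < etaOf ν) :
    ∃ c : ℝ, 0 < c ∧ c ≤ 1 / 2 ∧ ∀ μ σ δ : ℝ, 0 < μ → 0 < σ → 0 < δ → δ < c * σ →
      zigzagEnergy μ ν σ δ < squareGridEnergy μ ν σ := by
  -- Exceeding the threshold already forces `ν ≥ 0`, so the expansion applies.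
  have hν0 : 0 ≤ ν := by
    have h := (sqrt_two_sub_one_lt_etaOf_iff hν).1 hη
    have : 1 / √2 ≤ 1 := by
      rw [div_le_one (by positivity)]; exact Real.one_le_sqrt.2 one_le_two
    linarith
  have hη0 := etaOf_nonneg hν0 hν
  -- Below this bound on `δ/σ` the negative linear term beats the error `12 (δ/σ)²`.
  refine ⟨min (1 / 2) ((etaOf ν - (√2 - 1)) / 12),
    lt_min one_half_pos (div_pos (by linarith) (by norm_num)), min_le_left _ _,
    fun μ σ δ hμ hσ hδ hlt => ?_⟩
  have hx : δ / σ < min (1 / 2) ((etaOf ν - (√2 - 1)) / 12) := (div_lt_iff₀ hσ).2 hlt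
  obtain ⟨hx₁, hx₂⟩ := lt_min_iff.1 hx
  have hδσ : 2 * δ < σ := by rw [div_lt_iff₀ hσ] at hx₁; linarith
  obtain ⟨r, hr, h⟩ := exists_toReal_zigzagEnergy_eq hμ hν0 hν hσ hδ.le hδσ
  obtain ⟨r₀, hr₀, h₀⟩ := exists_toReal_zigzagEnergy_eq hμ hν0 hν hσ le_rfl
    (by linarith : 2 * (0 : ℝ) < σ)
  rw [zero_div, zero_pow two_ne_zero, mul_zero, abs_nonpos_iff] at hr₀
  have hfin : ∀ δ, 0 ≤ δ → 2 * δ < σ → zigzagEnergy μ ν σ δ ≠ ∞ := fun δ h₁ h₂ => by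
    rw [zigzagEnergy_eq hμ hν0 hν hσ h₁ h₂]; exact ENNReal.ofReal_ne_top
  rw [← zigzagEnergy_zero μ ν hσ, ← ENNReal.toReal_lt_toReal (hfin δ hδ.le hδσ)
    (hfin 0 le_rfl (by linarith)), h, h₀, hr₀]
  have hx0 : 0 < δ / σ := by positivity
  have hneg : δ / σ * (√2 - 1 - etaOf ν) + r < 0 := by
    have := mul_lt_mul_of_pos_left hx₂ hx0
    have := (abs_le.1 hr).2
    nlinarith
  have hpos : 0 < 4 * σ ^ 2 * (μ / (4 * Real.pi)) := by positivity
  refine mul_lt_mul_of_pos_left ?_ hpos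
  rw [zero_div]
  linarith

end

theorem mainTheorem2 :
    -- the value of `ψ_∞` at multiples of a basis vector
    (∀ μ ν : ℝ, 0 < μ → -1 < ν → ν < 1 / 2 →
      ∀ (i : Fin 2) (k : ℝ) (n : Plane), ‖n‖ = 1 →
        psiInfCubic μ ν (k • Plane.e i) n =
          ENNReal.ofReal
            (μ / (4 * Real.pi) * |k| * (1 + etaOf ν * (inner ℝ n (Plane.e i)) ^ 2))) ∧
    -- the value of `ψ_∞` at multiples of `e₁ + e₂`
    (∀ μ ν : ℝ, 0 < μ → 0 ≤ ν → ν < 1 / 2 →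
      ∀ k : ℝ, psiInfCubic μ ν (k • (Plane.e 0 + Plane.e 1)) diagNormal =
        ENNReal.ofReal (μ / (4 * Real.pi) * (2 * |k|))) ∧
    -- the cell energy
    (∀ μ ν σ δ : ℝ, 0 < μ → 0 ≤ ν → ν < 1 / 2 → 0 < σ → 0 ≤ δ → 2 * δ < σ →
      zigzagEnergy μ ν σ δ = ENNReal.ofReal (4 * σ * (μ / (4 * Real.pi)) *
        (√(δ ^ 2 + (σ / 2 - δ) ^ 2)
          + etaOf ν * ((σ / 2 - δ) ^ 2 / √(δ ^ 2 + (σ / 2 - δ) ^ 2)) + δ * √2))) ∧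
    -- its expansion, with a universal constant in the error term
    (∃ C : ℝ, ∀ μ ν σ δ : ℝ, 0 < μ → 0 ≤ ν → ν < 1 / 2 → 0 < σ → 0 ≤ δ → 2 * δ < σ →
      ∃ r : ℝ, |r| ≤ C * (δ / σ) ^ 2 ∧
        (zigzagEnergy μ ν σ δ).toReal = 4 * σ ^ 2 * (μ / (4 * Real.pi)) *
          ((1 + etaOf ν) / 2 + δ / σ * (√2 - 1 - etaOf ν) + r)) ∧
    -- the plain square grid is the case `δ = 0`
    (∀ μ ν σ : ℝ, 0 < μ → -1 < ν → ν < 1 / 2 → 0 < σ →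
      zigzagEnergy μ ν σ 0 = squareGridEnergy μ ν σ) ∧
    -- the threshold
    (∀ ν : ℝ, -1 < ν → ν < 1 / 2 → (√2 - 1 < etaOf ν ↔ 1 - 1 / √2 < ν)) ∧
    -- above the threshold, small zig-zags have strictly lower energy than the square grid
    (∀ ν : ℝ, -1 < ν → ν < 1 / 2 → √2 - 1 < etaOf ν →
      ∃ c : ℝ, 0 < c ∧ c ≤ 1 / 2 ∧ ∀ μ σ δ : ℝ, 0 < μ → 0 < σ → 0 < δ → δ < c * σ →
        zigzagEnergy μ ν σ δ < squareGridEnergy μ ν σ) := by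
  refine ⟨fun μ ν hμ hν hν' i k n hn => psiInfCubic_smul_e hμ hν hν' i k hn,
    fun μ ν hμ hν hν' k => psiInfCubic_smul_diag hμ hν hν' k,
    fun μ ν σ δ hμ hν hν' hσ hδ hδσ => zigzagEnergy_eq hμ hν hν' hσ hδ hδσ,
    ⟨12, fun μ ν σ δ hμ hν hν' hσ hδ hδσ =>
      exists_toReal_zigzagEnergy_eq hμ hν hν' hσ hδ hδσ⟩,
    fun μ ν σ _ _ _ hσ => zigzagEnergy_zero μ ν hσ,
    fun ν _ hν' => sqrt_two_sub_one_lt_etaOf_iff hν',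
    fun ν _ hν' hη => exists_zigzagEnergy_lt hν' hη⟩
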